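/- Let $K$ be an algebraic number field and let $\mathcal{O}$ be an order of $K$, that is, a subring of $K$ (with unity) which is finitely generated as a $\mathbb{Z}$-module and whose $\mathbb{Z}$-rank is $[K:\mathbb{Q}]$. Let $\operatorname{disc}\mathcal{O}=\det\big(\operatorname{Tr}_{K/\mathbb{Q}}(b_ib_j)\big)_{i,j}\in\mathbb{Z}$ be its discriminant, where $(b_i)$ is any $\mathbb{Z}$-basis of $\mathcal{O}$. Let $n\ge 2$ be an integer. Then every matrix $M\in M_n(\mathcal{O})$ is a sum of sixth powers in $M_n(\mathcal{O})$, i.e. $M=\sum_{i=1}^{r}M_i^6$ for some $r$ and some $M_1,\dots,M_r\in M_n(\mathcal{O})$, if and only if $\gcd(6,\operatorname{disc}\mathcal{O})=1$. -/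

import Mathlib

/-- A subring `O` of a number field `K` is an order of `K` if it is finitely generated as a
`ℤ`-module and its rank over `ℤ` is the degree of `K` over `ℚ`. -/
structure IsNumberFieldOrder {K : Type*} [Field K] [NumberField K] (O : Subring K) : Prop where
  finite : Module.Finite ℤ O
  finrank_eq : Module.finrank ℤ O = Module.finrank ℚ K

/-- An order is a free `ℤ`-module: it is finitely generated and torsion-free. -/
theorem IsNumberFieldOrder.free {K : Type*} [Field K] [NumberField K] {O : Subring K}
    (hO : IsNumberFieldOrder O) : Module.Free ℤ O := by
  have := hO.finite
  infer_instance

/-- The discriminant of an order `O`: the determinant of the matrix `(Tr (b i * b j))` for a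
`ℤ`-basis `b` of `O`. -/
noncomputable def orderDiscr {K : Type*} [Field K] [NumberField K] (O : Subring K)
    (hO : IsNumberFieldOrder O) : ℤ :=
  haveI := hO.finite
  haveI := hO.free
  Algebra.discr ℤ (Module.Free.chooseBasis ℤ O)

/-- The discriminant of an order can be computed in any `ℤ`-basis. -/
theorem orderDiscr_eq_discr {K : Type*} [Field K] [NumberField K] (O : Subring K)
    (hO : IsNumberFieldOrder O) {ι : Type*} [Fintype ι] [DecidableEq ι]
    (b : Module.Basis ι ℤ O) : orderDiscr O hO = Algebra.discr ℤ b := by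
  have := hO.finite
  have := hO.free
  let b₀ := (Module.Free.chooseBasis ℤ O).reindex
    ((Module.Free.chooseBasis ℤ O).indexEquiv b)
  rw [Algebra.discr_eq_discr O b b₀, Module.Basis.coe_reindex, Algebra.discr_reindex]
  rfl

/-- `a` is a sum of `k`-th powers: `a = ∑ i, x i ^ k` for finitely many elements `x i`. -/
def IsSumOfPowers {R : Type*} [Semiring R] (k : ℕ) (a : R) : Prop :=
  ∃ (r : ℕ) (x : Fin r → R), a = ∑ i, x i ^ k

/-! Over any commutative ring, trace-zero `2 × 2` matrices are sums of sixth powers, so only the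
trace matters. The attainable traces form a group containing `6R`, all `9d² - 6d` and all `-2d³`; it
is all of `R` once squares exhaust `R` modulo 2 and cubes modulo 3 (`mem_tracePowerSums`). Block
embeddings give larger `n`. Conversely `tr(M^p) ≡ (tr M)^p` mod `p` for `p = 2, 3` forces these
conditions. Finally, Frobenius is onto on `O/pO` iff its trace form is nondegenerate, that is, iff
`p ∤ disc O` (`not_dvd_discr_iff`). -/

/-- The additive monoid of sums of `k`-th powers. -/
def powerSums (R : Type*) [Semiring R] (k : ℕ) : AddSubmonoid R :=
  AddSubmonoid.closure (Set.range fun x : R => x ^ k)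

theorem pow_mem_powerSums {R : Type*} [Semiring R] {k : ℕ} (x : R) : x ^ k ∈ powerSums R k :=
  AddSubmonoid.subset_closure ⟨x, rfl⟩

theorem isSumOfPowers_iff_mem_powerSums {R : Type*} [Semiring R] {k : ℕ} {a : R} :
    IsSumOfPowers k a ↔ a ∈ powerSums R k := by
  constructor
  · rintro ⟨r, x, rfl⟩
    exact sum_mem fun i _ => pow_mem_powerSums (x i)
  · intro h
    induction h using AddSubmonoid.closure_induction with
    | mem x hx =>
      obtain ⟨y, rfl⟩ := hx
      exact ⟨1, fun _ => y, by simp⟩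
    | zero => exact ⟨0, Fin.elim0, by simp⟩
    | add x y _ _ hx hy =>
      obtain ⟨r, f, rfl⟩ := hx
      obtain ⟨s, g, rfl⟩ := hy
      exact ⟨r + s, Fin.append f g, by simp [Fin.sum_univ_add]⟩

theorem IsIdempotentElem.mem_powerSums {R : Type*} [Semiring R] {k : ℕ} (hk : k ≠ 0) {e : R}
    (he : IsIdempotentElem e) : e ∈ powerSums R k := by
  obtain ⟨m, rfl⟩ := Nat.exists_eq_succ_of_ne_zero hk
  simpa [he.pow_succ_eq m] using pow_mem_powerSums (k := m.succ) e

/-! ### Sixth powers of `2 × 2` matrices -/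

section FinTwo

variable {R : Type*} [CommRing R]

theorem finTwo_pow_six (M : Matrix (Fin 2) (Fin 2) R) : M ^ 6 = M * M * (M * M * (M * M)) := by
  rw [← pow_three, ← pow_two, ← pow_mul]

theorem finTwo_idempotent_mem_powerSums {k : ℕ} (hk : k ≠ 0) (a b c d : R) (h1 : a * a + b * c = a)
    (h2 : a * b + b * d = b) (h3 : c * a + d * c = c) (h4 : c * b + d * d = d) :
    !![a, b; c, d] ∈ powerSums (Matrix (Fin 2) (Fin 2) R) k := by
  refine IsIdempotentElem.mem_powerSums hk ?_
  rw [IsIdempotentElem, Matrix.mul_fin_two, h1, h2, h3, h4]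

/-- The matrix used squares to `-d • 1`. The case `d = 1` puts `-1` among the sums, which allows
subtraction from idempotents. -/
theorem neg_cube_scalar_mem_powerSums (d : R) :
    !![-d ^ 3, 0; 0, -d ^ 3] ∈ powerSums (Matrix (Fin 2) (Fin 2) R) 6 := by
  convert pow_mem_powerSums (k := 6) !![0, -d; 1, 0] using 1
  simp only [finTwo_pow_six, Matrix.mul_fin_two]
  congr <;> ring_nf

theorem upper_mem_powerSums (b : R) :
    !![0, b; 0, 0] ∈ powerSums (Matrix (Fin 2) (Fin 2) R) 6 := by
  convert add_mem (add_mem (neg_cube_scalar_mem_powerSums (1 : R))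
    (finTwo_idempotent_mem_powerSums (k := 6) (by simp) 1 b 0 0
      (by ring) (by ring) (by ring) (by ring)))
    (finTwo_idempotent_mem_powerSums (k := 6) (by simp) 0 0 0 (1 : R)
      (by ring) (by ring) (by ring) (by ring)) using 1
  simp

theorem lower_mem_powerSums (b : R) :
    !![0, 0; b, 0] ∈ powerSums (Matrix (Fin 2) (Fin 2) R) 6 := by
  convert add_mem (add_mem (neg_cube_scalar_mem_powerSums (1 : R))
    (finTwo_idempotent_mem_powerSums (k := 6) (by simp) 1 0 b 0
      (by ring) (by ring) (by ring) (by ring)))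
    (finTwo_idempotent_mem_powerSums (k := 6) (by simp) 0 0 0 (1 : R)
      (by ring) (by ring) (by ring) (by ring)) using 1
  simp

theorem diag_neg_mem_powerSums (x : R) :
    !![x, 0; 0, -x] ∈ powerSums (Matrix (Fin 2) (Fin 2) R) 6 := by
  -- The matrix with rows `(x, x)` and `(1 - x, 1 - x)` has trace 1 and determinant 0, hence is
  -- idempotent.
  convert add_mem (add_mem (add_mem (add_mem (neg_cube_scalar_mem_powerSums (1 : R))
    (finTwo_idempotent_mem_powerSums (k := 6) (by simp) x x (1 - x) (1 - x)
      (by ring) (by ring) (by ring) (by ring)))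
    (finTwo_idempotent_mem_powerSums (k := 6) (by simp) 1 0 0 (0 : R)
      (by ring) (by ring) (by ring) (by ring)))
    (upper_mem_powerSums (-x))) (lower_mem_powerSums (-(1 - x))) using 1
  simp [neg_add_eq_sub]

/-- Every `2 × 2` matrix of trace zero is a sum of sixth powers. -/
theorem mem_powerSums_of_trace_eq_zero (M : Matrix (Fin 2) (Fin 2) R) (h : M.trace = 0) :
    M ∈ powerSums (Matrix (Fin 2) (Fin 2) R) 6 := by
  rw [Matrix.trace_fin_two] at h
  convert add_mem (add_mem (diag_neg_mem_powerSums (M 0 0)) (upper_mem_powerSums (M 0 1)))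
    (lower_mem_powerSums (M 1 0)) using 1
  rw [Matrix.eta_fin_two M, eq_neg_of_add_eq_zero_right h]
  simp

theorem mem_powerSums_of_trace_eq {M N : Matrix (Fin 2) (Fin 2) R} (h : M.trace = N.trace)
    (hN : N ∈ powerSums (Matrix (Fin 2) (Fin 2) R) 6) :
    M ∈ powerSums (Matrix (Fin 2) (Fin 2) R) 6 := by
  have := add_mem (mem_powerSums_of_trace_eq_zero (M - N) (by simp [h])) hN
  rwa [sub_add_cancel] at this

variable (R) in
/-- The traces of sums of sixth powers of `2 × 2` matrices. -/
def tracePowerSums : AddSubmonoid R :=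
  (powerSums (Matrix (Fin 2) (Fin 2) R) 6).map (Matrix.traceAddMonoidHom (Fin 2) R)

theorem trace_mem_tracePowerSums_iff {M : Matrix (Fin 2) (Fin 2) R} :
    M.trace ∈ tracePowerSums R ↔ M ∈ powerSums (Matrix (Fin 2) (Fin 2) R) 6 :=
  ⟨fun ⟨_, hN, h⟩ => mem_powerSums_of_trace_eq h.symm hN, fun h => ⟨M, h, rfl⟩⟩

theorem neg_two_mul_cube_mem_tracePowerSums (d : R) : -(2 * d ^ 3) ∈ tracePowerSums R := by
  convert trace_mem_tracePowerSums_iff.2 (neg_cube_scalar_mem_powerSums d) using 1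
  rw [Matrix.trace_fin_two_of]
  ring

theorem one_mem_tracePowerSums : (1 : R) ∈ tracePowerSums R := by
  convert trace_mem_tracePowerSums_iff.2
    (finTwo_idempotent_mem_powerSums (k := 6) (by simp) 1 0 0 (0 : R)
      (by ring) (by ring) (by ring) (by ring)) using 1
  simp

/-- This is the sixth power sum of the roots of `t² - t + d`. -/
theorem trace_companion_mem_tracePowerSums (d : R) :
    1 - 6 * d + 9 * d ^ 2 - 2 * d ^ 3 ∈ tracePowerSums R := by
  convert trace_mem_tracePowerSums_iff.2 (pow_mem_powerSums (k := 6) !![1, -d; 1, 0]) using 1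
  simp only [finTwo_pow_six, Matrix.mul_fin_two]
  rw [Matrix.trace_fin_two_of]
  ring

/-- Second difference of `2d³`; signs are absorbed because cubing is odd. -/
theorem twelve_mul_mem_tracePowerSums (x : R) : 12 * x ∈ tracePowerSums R := by
  convert add_mem (add_mem (add_mem (neg_two_mul_cube_mem_tracePowerSums (-(x + 1)))
    (neg_two_mul_cube_mem_tracePowerSums (-(x - 1))))
    (neg_two_mul_cube_mem_tracePowerSums x)) (neg_two_mul_cube_mem_tracePowerSums x) using 1
  ring

theorem neg_mem_tracePowerSums {x : R} (hx : x ∈ tracePowerSums R) : -x ∈ tracePowerSums R := by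
  convert add_mem (nsmul_mem hx 11) (twelve_mul_mem_tracePowerSums (-x)) using 1
  rw [nsmul_eq_mul]
  push_cast
  ring

theorem quadratic_mem_tracePowerSums (d : R) : 9 * d ^ 2 - 6 * d ∈ tracePowerSums R := by
  convert add_mem (add_mem (trace_companion_mem_tracePowerSums d)
    (neg_mem_tracePowerSums one_mem_tracePowerSums))
    (neg_mem_tracePowerSums (neg_two_mul_cube_mem_tracePowerSums d)) using 1
  ring

theorem six_mul_mem_tracePowerSums (x : R) : 6 * x ∈ tracePowerSums R := by
  -- Polarizing `9d² - 6d` at `x` and `1` gives `18x`.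
  convert add_mem (add_mem (add_mem (quadratic_mem_tracePowerSums (x + 1))
    (neg_mem_tracePowerSums (quadratic_mem_tracePowerSums x)))
    (neg_mem_tracePowerSums (quadratic_mem_tracePowerSums 1)))
    (neg_mem_tracePowerSums (twelve_mul_mem_tracePowerSums x)) using 1
  ring

theorem mem_tracePowerSums (h2 : ∀ x : R, ∃ y z, x = y ^ 2 + 2 * z)
    (h3 : ∀ x : R, ∃ y z, x = y ^ 3 + 3 * z) (x : R) : x ∈ tracePowerSums R := by
  obtain ⟨y, z, hy⟩ := h2 x
  obtain ⟨u, v, hu⟩ := h3 x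
  have hthree : 3 * x ∈ tracePowerSums R := by
    convert add_mem (quadratic_mem_tracePowerSums y)
      (six_mul_mem_tracePowerSums (y + z - y ^ 2)) using 1
    rw [hy]
    ring
  have htwo : -(2 * x) ∈ tracePowerSums R := by
    convert add_mem (neg_two_mul_cube_mem_tracePowerSums u)
      (six_mul_mem_tracePowerSums (-v)) using 1
    rw [hu]
    ring
  convert add_mem hthree htwo using 1
  ring

end FinTwo

/-! ### From `2 × 2` to larger matrices -/

section Embedding

variable {R : Type*} [CommRing R] {n : Type*} [Fintype n] [DecidableEq n]

/-- Sums of powers are preserved by `B ↦ U * B * V` when `V * U = 1`. -/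
theorem mul_mul_mem_powerSums {m : Type*} [Fintype m] [DecidableEq m] {k : ℕ} (hk : k ≠ 0)
    {U : Matrix n m R} {V : Matrix m n R} (h : V * U = 1) {B : Matrix m m R}
    (hB : B ∈ powerSums (Matrix m m R) k) : U * B * V ∈ powerSums (Matrix n n R) k := by
  have hpow (C : Matrix m m R) (l : ℕ) : (U * C * V) ^ (l + 1) = U * C ^ (l + 1) * V := by
    induction l with
    | zero => simp
    | succ l ih =>
      rw [pow_succ, ih, pow_succ C (l + 1)]
      calc U * C ^ (l + 1) * V * (U * C * V) = U * C ^ (l + 1) * (V * U) * C * V := by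
            simp only [Matrix.mul_assoc]
        _ = U * (C ^ (l + 1) * C) * V := by rw [h]; simp only [Matrix.mul_assoc, Matrix.mul_one]
  induction hB using AddSubmonoid.closure_induction with
  | mem x hx =>
    obtain ⟨C, rfl⟩ := hx
    obtain ⟨l, rfl⟩ := Nat.exists_eq_succ_of_ne_zero hk
    exact hpow C l ▸ pow_mem_powerSums _
  | zero => simp
  | add x y _ _ hx hy =>
    rw [Matrix.mul_add, Matrix.add_mul]
    exact add_mem hx hy

theorem mem_powerSums_of_nontrivial [Nontrivial n] {k : ℕ} (hk : k ≠ 0)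
    (h : ∀ B : Matrix (Fin 2) (Fin 2) R, B ∈ powerSums (Matrix (Fin 2) (Fin 2) R) k)
    (M : Matrix n n R) : M ∈ powerSums (Matrix n n R) k := by
  -- Every matrix unit lies in a `2 × 2` block, as `n` has two distinct indices.
  have key (f : Fin 2 → n) (hf : f.Injective) (a b : Fin 2) (x : R) :
      Matrix.single (f a) (f b) x ∈ powerSums (Matrix n n R) k := by
    convert mul_mul_mem_powerSums (U := (1 : Matrix n n R).submatrix id f)
      (V := (1 : Matrix n n R).submatrix f id) hk ?_ (h (Matrix.single a b x)) using 1
    · ext i j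
      simp [Matrix.mul_apply, Matrix.single_apply, Matrix.one_apply, Finset.sum_ite, ite_and,
        eq_comm]
      split_ifs <;> rfl
    · ext i j
      simp [Matrix.mul_apply, Matrix.one_apply, hf.eq_iff]
  induction M using Matrix.induction_on with
  | h_add p q hp hq => exact add_mem hp hq
  | h_std_basis i j x =>
    obtain ⟨l, hl⟩ : ∃ l, l ≠ i := exists_ne i
    by_cases hij : i = j
    · subst hij
      simpa using key ![i, l] (by simp [Function.Injective, Fin.forall_fin_two, hl, hl.symm]) 0 0 x
    · simpa using key ![i, j]
        (by simp [Function.Injective, Fin.forall_fin_two, hij, Ne.symm hij]) 0 1 x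

end Embedding

/-! ### Traces of powers modulo 2 and 3 -/

section TracePow

variable {R : Type*} [CommRing R] {n : Type*} [Fintype n] [DecidableEq n]

/-- Cyclicity of the trace merges the cross terms, so the congruence passes from matrix units to
sums. -/
theorem trace_sq_eq (M : Matrix n n R) : ∃ z, (M ^ 2).trace = M.trace ^ 2 + 2 * z := by
  cases isEmpty_or_nonempty n
  · exact ⟨0, by simp [Matrix.trace]⟩
  induction M using Matrix.induction_on with
  | h_add p q hp hq =>
    obtain ⟨y, hy⟩ := hp
    obtain ⟨z, hz⟩ := hq
    refine ⟨y + z + (p * q).trace - p.trace * q.trace, ?_⟩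
    have : ((p + q) ^ 2).trace = (p ^ 2).trace + (q ^ 2).trace + 2 * (p * q).trace := by
      simp only [pow_two, add_mul, mul_add, Matrix.trace_add, Matrix.trace_mul_comm q p]
      ring
    rw [this, hy, hz, Matrix.trace_add]
    ring
  | h_std_basis i j x =>
    refine ⟨0, ?_⟩
    by_cases h : i = j
    · subst h
      simp [pow_two]
    · simp [pow_two, h, Ne.symm h]

theorem trace_cube_eq (M : Matrix n n R) : ∃ z, (M ^ 3).trace = M.trace ^ 3 + 3 * z := by
  cases isEmpty_or_nonempty n
  · exact ⟨0, by simp [Matrix.trace]⟩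
  induction M using Matrix.induction_on with
  | h_add p q hp hq =>
    obtain ⟨y, hy⟩ := hp
    obtain ⟨z, hz⟩ := hq
    refine ⟨y + z + (p * p * q).trace + (p * q * q).trace
      - p.trace ^ 2 * q.trace - p.trace * q.trace ^ 2, ?_⟩
    have : ((p + q) ^ 3).trace = (p ^ 3).trace + (q ^ 3).trace
        + 3 * (p * p * q).trace + 3 * (p * q * q).trace := by
      have h1 : (p * q * p).trace = (p * p * q).trace := Matrix.trace_mul_cycle _ _ _
      have h2 : (q * p * p).trace = (p * p * q).trace := (Matrix.trace_mul_cycle _ _ _).symm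
      have h3 : (q * p * q).trace = (p * q * q).trace := by
        rw [Matrix.trace_mul_cycle, Matrix.trace_mul_cycle]
      have h4 : (q * q * p).trace = (p * q * q).trace := Matrix.trace_mul_cycle _ _ _
      simp only [pow_three', add_mul, mul_add, Matrix.trace_add, h1, h2, h3, h4]
      ring
    rw [this, hy, hz, Matrix.trace_add]
    ring
  | h_std_basis i j x =>
    refine ⟨0, ?_⟩
    by_cases h : i = j
    · subst h
      simp [pow_three]
    · simp [pow_three, h, Ne.symm h]

/-- If sums of `p * q`-th powers exhaust the matrices, and the trace commutes with `p`-th powers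
modulo `p`, then the Frobenius map is surjective modulo `p`. -/
theorem exists_eq_pow_add_of_forall_mem_powerSums [Nonempty n] {p q : ℕ} (hp : p.Prime)
    (ht : ∀ M : Matrix n n R, ∃ z, (M ^ p).trace = M.trace ^ p + p * z)
    (h : ∀ M : Matrix n n R, M ∈ powerSums (Matrix n n R) (q * p)) (x : R) :
    ∃ y z, x = y ^ p + p * z := by
  have key (M : Matrix n n R) : ∃ y z, M.trace = y ^ p + p * z := by
    induction h M using AddSubmonoid.closure_induction with
    | mem M hM =>
      obtain ⟨N, rfl⟩ := hM
      obtain ⟨z, hz⟩ := ht (N ^ q)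
      exact ⟨_, z, by simpa only [pow_mul] using hz⟩
    | zero => exact ⟨0, 0, by simp [hp.ne_zero]⟩
    | add M N _ _ hM hN =>
      obtain ⟨y, z, hM⟩ := hM
      obtain ⟨u, v, hN⟩ := hN
      obtain ⟨r, hr⟩ := exists_add_pow_prime_eq hp y u
      refine ⟨y + u, z + v - y * u * r, ?_⟩
      rw [hr, Matrix.trace_add, hM, hN]
      ring
  obtain ⟨i⟩ := ‹Nonempty n›
  simpa using key (Matrix.single i i x)

theorem forall_mem_powerSums_six_iff [Nontrivial n] :
    (∀ M : Matrix n n R, M ∈ powerSums (Matrix n n R) 6) ↔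
      (∀ x : R, ∃ y z, x = y ^ 2 + (2 : ℕ) * z) ∧ (∀ x : R, ∃ y z, x = y ^ 3 + (3 : ℕ) * z) := by
  refine ⟨fun h => ⟨fun x => ?_, fun x => ?_⟩, fun ⟨h2, h3⟩ => ?_⟩
  · exact exists_eq_pow_add_of_forall_mem_powerSums (q := 3) Nat.prime_two trace_sq_eq h x
  · exact exists_eq_pow_add_of_forall_mem_powerSums (q := 2) Nat.prime_three trace_cube_eq h x
  · exact mem_powerSums_of_nontrivial (by simp) fun B =>
      trace_mem_tracePowerSums_iff.1 (mem_tracePowerSums h2 h3 _)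

end TracePow

open scoped TensorProduct

/-! ### Trace forms and Frobenius -/

section FiniteDimensional

variable {F A : Type*} [Field F] [CommRing A] [Algebra F A]

theorem Algebra.discr_ne_zero_iff_traceForm_nondegenerate {ι : Type*} [Fintype ι] [DecidableEq ι]
    (b : Module.Basis ι F A) : Algebra.discr F b ≠ 0 ↔
      ∀ x : A, (∀ y, Algebra.trace F A (x * y) = 0) → x = 0 := by
  have h : LinearMap.BilinForm.toMatrix b (Algebra.traceForm F A) = Algebra.traceMatrix F b := by
    ext i j
    rw [Algebra.traceForm_toMatrix]
    rfl
  rw [Algebra.discr_def, ← h, ← LinearMap.BilinForm.nondegenerate_iff_det_ne_zero]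
  refine ⟨fun h x hx => h.1 x hx, fun h => ⟨h, fun x hx => h x fun y => ?_⟩⟩
  rw [mul_comm]
  exact hx y

theorem isReduced_of_traceForm_nondegenerate
    (h : ∀ x : A, (∀ y, Algebra.trace F A (x * y) = 0) → x = 0) : IsReduced A :=
  ⟨fun x hx => h x fun y => (Algebra.isNilpotent_trace_of_isNilpotent
    ((Commute.all x y).isNilpotent_mul_right hx)).eq_zero⟩

/-- The trace on an idempotent factor `A ⧸ (1 - e)` of `A`. -/
theorem trace_mul_idempotent [Module.Finite F A] {e : A} (he : IsIdempotentElem e) (x : A) :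
    Algebra.trace F A (e * x) =
      Algebra.trace F (A ⧸ Ideal.span {1 - e}) (Ideal.Quotient.mk _ x) := by
  let f : A →ₐ[F] (A ⧸ Ideal.span {1 - e}) × (A ⧸ Ideal.span {e}) :=
    (Ideal.Quotient.mkₐ F _).prod (Ideal.Quotient.mkₐ F _)
  have he' : e * e = e := he
  have hf : Function.Bijective f := by
    constructor
    · refine (injective_iff_map_eq_zero f).2 fun a ha => ?_
      obtain ⟨h1, h2⟩ := Prod.ext_iff.1 ha
      obtain ⟨c, hc⟩ := Ideal.mem_span_singleton.1 (Ideal.Quotient.eq_zero_iff_mem.1 h1)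
      obtain ⟨d, hd⟩ := Ideal.mem_span_singleton.1 (Ideal.Quotient.eq_zero_iff_mem.1 h2)
      linear_combination e * hc + (1 - e) * hd - (c + d) * he'
    · rintro ⟨y, z⟩
      obtain ⟨y, rfl⟩ := Ideal.Quotient.mk_surjective y
      obtain ⟨z, rfl⟩ := Ideal.Quotient.mk_surjective z
      refine ⟨e * y + (1 - e) * z, Prod.ext ?_ ?_⟩
      · refine Ideal.Quotient.eq.2 (Ideal.mem_span_singleton.2 ⟨z - y, ?_⟩)
        ring
      · refine Ideal.Quotient.eq.2 (Ideal.mem_span_singleton.2 ⟨y - z, ?_⟩)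
        ring
  have h1 : (f (e * x)).1 = Ideal.Quotient.mk _ x :=
    Ideal.Quotient.eq.2 (Ideal.mem_span_singleton.2 ⟨-x, by ring⟩)
  have h2 : (f (e * x)).2 = 0 :=
    Ideal.Quotient.eq_zero_iff_mem.2 (Ideal.mem_span_singleton.2 ⟨x, rfl⟩)
  rw [← Algebra.trace_eq_of_algEquiv (AlgEquiv.ofBijective f hf), AlgEquiv.ofBijective_apply,
    Algebra.trace_prod_apply, h1, h2, map_zero, add_zero]

/-- Surjectivity makes each maximal ideal equal to its square, so it is generated by an idempotent
and its residue field splits off as a factor, separable over the perfect field `F`. A nonzero `x`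
survives in some such factor. -/
theorem traceForm_nondegenerate_of_surjective_pow [PerfectField F] [Module.Finite F A] [IsReduced A]
    {p : ℕ} (hp : 1 < p) (hs : Function.Surjective fun x : A => x ^ p) (x : A)
    (hx : ∀ y, Algebra.trace F A (x * y) = 0) : x = 0 := by
  have : IsArtinianRing A := IsArtinianRing.of_finite F A
  by_contra hne
  obtain ⟨m, hm, hxm⟩ : ∃ m : Ideal A, m.IsMaximal ∧ x ∉ m := by
    by_contra! hall
    apply hne
    have hj : x ∈ (⊥ : Ideal A).jacobson := by
      rw [Ideal.jacobson, Ideal.mem_sInf]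
      exact fun {I} hI => hall I hI.2
    rw [IsArtinianRing.jacobson_eq_radical] at hj
    obtain ⟨k, hk⟩ := hj
    exact eq_zero_of_pow_eq_zero hk
  have hidem : IsIdempotentElem m := by
    refine le_antisymm Ideal.mul_le_left fun a ha => ?_
    obtain ⟨b, rfl⟩ := hs a
    have hb : b ∈ m := hm.isPrime.mem_of_pow_mem p ha
    obtain ⟨k, rfl⟩ := Nat.exists_eq_add_of_lt hp
    have : b ^ (1 + k + 1) = b ^ k * b * b := by ring
    change b ^ (1 + k + 1) ∈ m * m
    rw [this]
    exact Ideal.mul_mem_mul (m.mul_mem_left _ hb) hb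
  obtain ⟨e, he, rfl⟩ := (Ideal.isIdempotentElem_iff_of_fg m (IsNoetherian.noetherian m)).1 hidem
  obtain ⟨e, rfl⟩ : ∃ e', e = 1 - e' := ⟨1 - e, by ring⟩
  have he : IsIdempotentElem e := by simpa using he.one_sub
  change x ∉ Ideal.span {1 - e} at hxm
  change (Ideal.span {1 - e}).IsMaximal at hm
  let _ : Field (A ⧸ Ideal.span {1 - e}) := Ideal.Quotient.field _
  refine hxm (Ideal.Quotient.eq_zero_iff_mem.1
    ((traceForm_nondegenerate F (A ⧸ Ideal.span {1 - e})).1 _ fun y => ?_))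
  obtain ⟨y, rfl⟩ := Ideal.Quotient.mk_surjective y
  rw [Algebra.traceForm_apply, ← map_mul, ← trace_mul_idempotent he, mul_left_comm]
  exact hx _

end FiniteDimensional

/-- A finite commutative `𝔽_p`-algebra has nonzero discriminant if and only if its Frobenius map is
surjective. -/
theorem discr_ne_zero_iff_surjective_pow {p : ℕ} [Fact p.Prime] {A : Type*} [CommRing A]
    [Algebra (ZMod p) A] {ι : Type*} [Fintype ι] [DecidableEq ι] (b : Module.Basis ι (ZMod p) A) :
    Algebra.discr (ZMod p) b ≠ 0 ↔ Function.Surjective fun x : A => x ^ p := by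
  have hp : p.Prime := Fact.out
  have : Module.Finite (ZMod p) A := Module.Finite.of_basis b
  have : Finite A := Module.finite_of_finite (ZMod p)
  rw [Algebra.discr_ne_zero_iff_traceForm_nondegenerate]
  rcases subsingleton_or_nontrivial A with hA | hA
  · exact ⟨fun _ => Function.surjective_to_subsingleton _, fun _ _ _ => Subsingleton.elim _ _⟩
  have : CharP A p := charP_of_injective_algebraMap (algebraMap (ZMod p) A).injective p
  constructor
  · intro h
    have := isReduced_of_traceForm_nondegenerate h
    exact Finite.surjective_of_injective (frobenius_inj A p)
  · intro h
    have hinj : Function.Injective fun x : A => x ^ p := Finite.injective_iff_surjective.2 h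
    have : IsReduced A := by
      refine ⟨fun x ⟨k, hk⟩ => ?_⟩
      have hx : (fun x : A => x ^ p)^[k] x = (fun x : A => x ^ p)^[k] 0 := by
        have h0 : Function.IsFixedPt (fun x : A => x ^ p) 0 := zero_pow hp.ne_zero
        rw [(h0.iterate k).eq, pow_iterate]
        -- Since `p ^ k ≥ k`, the `k`-th Frobenius iterate kills `x`.
        obtain ⟨c, hc⟩ := Nat.exists_eq_add_of_le (Nat.lt_pow_self hp.one_lt (n := k)).le
        simp only [hc, pow_add, hk, zero_mul]
      exact hinj.iterate k hx
    exact traceForm_nondegenerate_of_surjective_pow hp.one_lt h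

theorem Algebra.discr_baseChange {R O : Type*} (S : Type*) [CommRing R] [CommRing O] [Algebra R O]
    [CommRing S] [Algebra R S] {ι : Type*} [Fintype ι] [DecidableEq ι] (b : Module.Basis ι R O) :
    Algebra.discr S (Algebra.TensorProduct.basis S b) = algebraMap R S (Algebra.discr R b) := by
  have := Module.Free.of_basis b
  have := Module.Finite.of_basis b
  rw [Algebra.discr_def, Algebra.discr_def, RingHom.map_det]
  congr 1
  ext i j
  simp only [Algebra.traceMatrix_apply, Algebra.traceForm_apply, RingHom.mapMatrix_apply,
    Matrix.map_apply, Algebra.TensorProduct.basis_apply, Algebra.TensorProduct.tmul_mul_tmul,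
    one_mul]
  rw [Algebra.trace_apply, ← Algebra.baseChange_lmul, LinearMap.trace_baseChange]
  rfl

/-- The discriminant commutes with base change to `ZMod p ⊗[ℤ] O`, which is `O/pO`. -/
theorem not_dvd_discr_iff {O : Type*} [CommRing O] {p : ℕ} (hp : p.Prime) {ι : Type*} [Fintype ι]
    [DecidableEq ι] (b : Module.Basis ι ℤ O) :
    ¬ (p : ℤ) ∣ Algebra.discr ℤ b ↔ ∀ x : O, ∃ y z, x = y ^ p + p * z := by
  have : Fact p.Prime := ⟨hp⟩
  have hsurj : Function.Surjective
      (Algebra.TensorProduct.includeRight : O →ₐ[ℤ] ZMod p ⊗[ℤ] O) := by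
    intro t
    induction t with
    | zero => exact ⟨0, map_zero _⟩
    | add s t hs ht =>
      obtain ⟨s, rfl⟩ := hs
      obtain ⟨t, rfl⟩ := ht
      exact ⟨s + t, map_add _ _ _⟩
    | tmul a x =>
      obtain ⟨a, rfl⟩ := ZMod.intCast_surjective a
      refine ⟨a • x, ?_⟩
      rw [Algebra.TensorProduct.includeRight_apply, TensorProduct.tmul_smul,
        TensorProduct.smul_tmul', zsmul_one]
  have hker (x : O) : (Algebra.TensorProduct.includeRight x : ZMod p ⊗[ℤ] O) = 0 ↔
      ∃ z, x = p * z := by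
    constructor
    · intro h
      have hdvd (i : ι) : (p : ℤ) ∣ b.repr x i := by
        have := congrArg (fun t => (Algebra.TensorProduct.basis (ZMod p) b).repr t i) h
        simpa [ZMod.intCast_zmod_eq_zero_iff_dvd] using this
      choose c hc using hdvd
      refine ⟨∑ i, c i • b i, ?_⟩
      rw [← b.sum_repr x, Finset.mul_sum]
      exact Finset.sum_congr rfl fun i _ => by rw [hc]; simp [mul_assoc]
    · rintro ⟨z, rfl⟩
      rw [map_mul, map_natCast, ← map_natCast (algebraMap (ZMod p) (ZMod p ⊗[ℤ] O)),
        ZMod.natCast_self, map_zero, zero_mul]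
  rw [← ZMod.intCast_zmod_eq_zero_iff_dvd, ← eq_intCast (algebraMap ℤ (ZMod p)),
    ← Algebra.discr_baseChange, ← ne_eq, discr_ne_zero_iff_surjective_pow]
  constructor
  · intro h x
    obtain ⟨t, ht⟩ := h (Algebra.TensorProduct.includeRight x)
    obtain ⟨y, rfl⟩ := hsurj t
    obtain ⟨z, hz⟩ := (hker (x - y ^ p)).1 (by rw [map_sub, map_pow, sub_eq_zero]; exact ht.symm)
    exact ⟨y, z, by rw [← hz]; ring⟩
  · intro h t
    obtain ⟨x, rfl⟩ := hsurj t
    obtain ⟨y, z, hx⟩ := h x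
    refine ⟨Algebra.TensorProduct.includeRight y, ?_⟩
    rw [← sub_eq_zero]
    change (_ : ZMod p ⊗[ℤ] O) ^ p - _ = 0
    rw [← map_pow, ← map_sub, hker]
    exact ⟨-z, by rw [hx]; ring⟩

theorem mainTheorem4 {K : Type*} [Field K] [NumberField K] (O : Subring K)
    (hO : IsNumberFieldOrder O) (n : ℕ) (hn : 2 ≤ n) :
    (∀ M : Matrix (Fin n) (Fin n) O, IsSumOfPowers 6 M) ↔ Int.gcd 6 (orderDiscr O hO) = 1 := by
  have := hO.finite
  have := hO.free
  have : Nontrivial (Fin n) := Fin.nontrivial_iff_two_le.2 hn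
  let b := Module.Free.chooseBasis ℤ O
  simp only [isSumOfPowers_iff_mem_powerSums]
  rw [forall_mem_powerSums_six_iff, orderDiscr_eq_discr O hO b,
    ← not_dvd_discr_iff Nat.prime_two b, ← not_dvd_discr_iff Nat.prime_three b,
    ← Int.isCoprime_iff_gcd_eq_one, show (6 : ℤ) = (2 : ℕ) * (3 : ℕ) by norm_num,
    IsCoprime.mul_left_iff, (Nat.prime_iff_prime_int.1 Nat.prime_two).coprime_iff_not_dvd,
    (Nat.prime_iff_prime_int.1 Nat.prime_three).coprime_iff_not_dvd]
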